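/- Setting. Let $\Sigma=\{0,1,\#\}$ and let the value domain be $\mathbb N\cup\{\infty\}$ with its usual order. A quantitative property is a function $p:\Sigma^\omega\to\mathbb N\cup\{\infty\}$, and a verdict function is a function $v:\Sigma^*\to\mathbb N\cup\{\infty\}$. For $f\in\Sigma^\omega$ let $v(f)=(v(s_i))_{i\in\mathbb N}$, where $s_i$ is the prefix of $f$ of length $i$. The function $v$ approximately monitors $p$ from below (resp. above) if $\limsup v(f)\le p(f)$ (resp. $p(f)\le\liminf v(f)$) for every $f\in\Sigma^\omega$. For verdict functions $v,v'$ that approximately monitor $p$ from below (resp. above), $v'$ is more precise than $v$ if $\limsup v(f)\le\limsup v'(f)$ (resp. $\liminf v'(f)\le\liminf v(f)$) for every $f\in\Sigma^\omega$, with strict inequality for at least one $f$. A $k$-counter machine is a deterministic machine with a finite set of states and $k$ integer registers, all initially $0$. On each input letter it takes the unique outgoing edge of its current state that carries this letter and whose test holds of the current register values; a test is a Boolean combination of comparisons $x\ge y$ between registers. It then performs the update of that edge, a finite sequence of instructions $x\leftarrow 0$ and $x\leftarrow x+1$, and moves to the target state. Each state has a fixed output rule: the output is $0$, or $\infty$,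 or the current value of one fixed register. A $k$-counter verdict function is a function $v:\Sigma^*\to\mathbb N\cup\{\infty\}$ such that, for some $k$-counter machine, $v(s)$ is the output of the machine after reading $s$, for every $s\in\Sigma^*$. Theorem. There exists a quantitative property $p:\Sigma^\omega\to\mathbb N\cup\{\infty\}$ such that for every integer $k>1$ the following holds: for every $k$-counter verdict function $v_k$ that approximately monitors $p$ from below (resp. above), there exists a $(k+1)$-counter verdict function $v_{k+1}$ that approximately monitors $p$ from below (resp. above) and is more precise than $v_k$. (The same $p$ serves for both cases and for all $k$.) -/

import Mathlib

open Filter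

/-- The ternary alphabet `{0, 1, #}`. -/
inductive Letter : Type
  | zero : Letter
  | one : Letter
  | hash : Letter

namespace QuantMonitor

section Verdicts

variable {A D : Type*} [CompleteLattice D]

/-- The prefix of length `n` of an infinite trace. -/
def pref (f : ℕ → A) (n : ℕ) : List A := (List.range n).map f

/-- Limit superior of the verdict sequence of `v` along the prefixes of `f`. -/
noncomputable def vLimsup (v : List A → D) (f : ℕ → A) : D :=
  limsup (fun n => v (pref f n)) atTop

/-- Limit inferior of the verdict sequence of `v` along the prefixes of `f`. -/
noncomputable def vLiminf (v : List A → D) (f : ℕ → A) : D :=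
  liminf (fun n => v (pref f n)) atTop

/-- `v` approximately monitors the quantitative property `p` from below. -/
def ApproxBelow (v : List A → D) (p : (ℕ → A) → D) : Prop :=
  ∀ f : ℕ → A, vLimsup v f ≤ p f

/-- `v` approximately monitors the quantitative property `p` from above. -/
def ApproxAbove (v : List A → D) (p : (ℕ → A) → D) : Prop :=
  ∀ f : ℕ → A, p f ≤ vLiminf v f

/-- `v₁` is more precise than `v₂`, as verdicts that monitor from below. -/
def MorePreciseBelow (v₁ v₂ : List A → D) : Prop :=
  (∀ f : ℕ → A, vLimsup v₂ f ≤ vLimsup v₁ f) ∧ ∃ g : ℕ → A, vLimsup v₂ g < vLimsup v₁ g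

/-- `v₁` is more precise than `v₂`, as verdicts that monitor from above. -/
def MorePreciseAbove (v₁ v₂ : List A → D) : Prop :=
  (∀ f : ℕ → A, vLiminf v₁ f ≤ vLiminf v₂ f) ∧ ∃ g : ℕ → A, vLiminf v₁ g < vLiminf v₂ g

end Verdicts

/-- An edge of a register machine. A test is identified with the set of valuations that
satisfy it. -/
structure Edge (X Q A : Type*) where
  src : Q
  letter : A
  test : Set (X → ℤ)
  update : (X → ℤ) → (X → ℤ)
  dst : Q

/-- Deterministic register machines with registers `X`, states `Q`, input alphabet `A` and
output domain `D`. -/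
structure RegisterMachine (X Q A D : Type*) where
  edges : Set (Edge X Q A)
  init : Q
  out : Q → (X → ℤ) → D
  deterministic : ∀ (q : Q) (a : A) (x : X → ℤ),
    ∃! e : Edge X Q A, e ∈ edges ∧ e.src = q ∧ e.letter = a ∧ x ∈ e.test

namespace RegisterMachine

variable {X Q A D : Type*}

/-- One transition between configurations (state, valuation) on reading a letter. -/
def Step (M : RegisterMachine X Q A D) (c : Q × (X → ℤ)) (a : A) (c' : Q × (X → ℤ)) : Prop :=
  ∃ e ∈ M.edges, e.src = c.1 ∧ e.letter = a ∧ c.2 ∈ e.test ∧ c' = (e.dst, e.update c.2)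

/-- `M.Reaches s c`: after reading the finite trace `s` from the initial configuration
(all registers `0`), the machine is in configuration `c`. -/
inductive Reaches (M : RegisterMachine X Q A D) : List A → Q × (X → ℤ) → Prop
  | nil : Reaches M [] (M.init, fun _ => 0)
  | snoc {s : List A} {c c' : Q × (X → ℤ)} {a : A} :
      Reaches M s c → M.Step c a c' → Reaches M (s ++ [a]) c'

/-- `M` generates the verdict function `v`. -/
def Generates (M : RegisterMachine X Q A D) (v : List A → D) : Prop :=
  ∀ s : List A, ∃ c : Q × (X → ℤ), M.Reaches s c ∧ M.out c.1 c.2 = v s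

end RegisterMachine

/-- Tests built from the instructions `x ≥ y`: their Boolean combinations. -/
inductive IsCounterTest {X : Type*} : Set (X → ℤ) → Prop
  | ge (x y : X) : IsCounterTest {w | w x ≥ w y}
  | univ : IsCounterTest Set.univ
  | compl {φ : Set (X → ℤ)} : IsCounterTest φ → IsCounterTest φᶜ
  | inter {φ ψ : Set (X → ℤ)} : IsCounterTest φ → IsCounterTest ψ → IsCounterTest (φ ∩ ψ)

/-- Updates built from the instructions `x ← 0` and `x ← x + 1`: finite (possibly empty)
sequences of such instructions. -/
inductive IsCounterUpdate {X : Type*} [DecidableEq X] : ((X → ℤ) → (X → ℤ)) → Prop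
  | skip : IsCounterUpdate (fun w => w)
  | reset {γ : (X → ℤ) → (X → ℤ)} (x : X) :
      IsCounterUpdate γ → IsCounterUpdate (fun w => Function.update (γ w) x 0)
  | incr {γ : (X → ℤ) → (X → ℤ)} (x : X) :
      IsCounterUpdate γ → IsCounterUpdate (fun w => Function.update (γ w) x (γ w x + 1))

/-- Counter machines with output domain `ℕ ∪ {∞}`. The output function is fixed in each state:
it is `0`, or `∞`, or the value of one register. (Registers of a counter machine are never
negative in reachable configurations, so `Int.toNat` only reads the value as a natural number.) -/
structure RegisterMachine.IsCounterMachine {X Q A : Type*} [DecidableEq X]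
    (M : RegisterMachine X Q A ℕ∞) : Prop where
  test : ∀ e ∈ M.edges, IsCounterTest e.test
  update : ∀ e ∈ M.edges, IsCounterUpdate e.update
  out : ∀ q : Q, (∀ w, M.out q w = 0) ∨ (∀ w, M.out q w = ⊤) ∨
    ∃ x : X, ∀ w, M.out q w = ((w x).toNat : ℕ∞)

/-- `v` is a `k`-counter verdict function: it is generated by a counter machine with finitely
many states and `k` registers. -/
def IsCounterVerdict {A : Type*} (k : ℕ) (v : List A → ℕ∞) : Prop :=
  ∃ (Q : Type) (_ : Finite Q) (M : RegisterMachine (Fin k) Q A ℕ∞),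
    M.IsCounterMachine ∧ M.Generates v

end QuantMonitor

/-!
The property assigns to a trace the number whose binary expansion, least significant bit first,
is written before the first `#`, and `∞` to a trace without `#`.

No counter machine computes this property, for either limit of its verdicts. Each edge raises a
register by a bounded amount, and only finitely many edges can ever be taken, so after `n` letters
the registers are at most linear in `n` (`RegisterMachine.IsCounterMachine.exists_bound`) and the
machine is in one of polynomially many configurations. Two of the `2 ^ n` binary words of length
`n` therefore lead to the same configuration (`exists_bitTrace_collision`). Continued by
`# # # …` they yield the same verdicts from then on, whereas their binary values differ, so that
the verdicts miss the property on one of them, say on `u # # # …`.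

The value of the property is settled once `u #` has been read. One further register, kept at this
value `c`, allows a machine that outputs `c` on all extensions of `u #` and behaves like the given
machine elsewhere (`IsCounterVerdict.ite_prefix`). The new verdicts are exact on the extensions of
`u #` and unchanged elsewhere, which makes them more precise both from below and from above.
-/

namespace QuantMonitor

/-! ### Prefixes of traces -/

section Prefixes

variable {A : Type*}

theorem pref_succ (f : ℕ → A) (n : ℕ) : pref f (n + 1) = pref f n ++ [f n] := by
  simp [pref, List.range_succ]

theorem length_pref (f : ℕ → A) (n : ℕ) : (pref f n).length = n := by
  simp [pref]

theorem pref_prefix_pref_iff {f g : ℕ → A} {m n : ℕ} :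
    pref g m <+: pref f n ↔ m ≤ n ∧ ∀ i < m, f i = g i := by
  rw [List.prefix_iff_getElem]
  simp only [length_pref]
  constructor
  · rintro ⟨h, H⟩
    refine ⟨h, fun i hi => ?_⟩
    simpa [pref] using (H i hi).symm
  · rintro ⟨h, H⟩
    refine ⟨h, fun i hi => ?_⟩
    simpa [pref] using (H i hi).symm

end Prefixes

/-! ### Runs of register machines -/

namespace RegisterMachine

variable {X Q A D : Type*} {M : RegisterMachine X Q A D}

theorem Reaches.exists_of_append_singleton {s : List A} {a : A} {c' : Q × (X → ℤ)}
    (h : M.Reaches (s ++ [a]) c') : ∃ c, M.Reaches s c ∧ M.Step c a c' := by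
  generalize ht : s ++ [a] = t at h
  cases h with
  | nil => simp at ht
  | snoc hr hs =>
    obtain ⟨rfl, hab⟩ := List.append_inj' ht rfl
    obtain rfl : a = _ := by simpa using hab
    exact ⟨_, hr, hs⟩

theorem Step.unique {c c₁ c₂ : Q × (X → ℤ)} {a : A} (h₁ : M.Step c a c₁) (h₂ : M.Step c a c₂) :
    c₁ = c₂ := by
  obtain ⟨e₁, he₁, hs₁, hl₁, ht₁, rfl⟩ := h₁
  obtain ⟨e₂, he₂, hs₂, hl₂, ht₂, rfl⟩ := h₂
  rw [(M.deterministic c.1 a c.2).unique ⟨he₁, hs₁, hl₁, ht₁⟩ ⟨he₂, hs₂, hl₂, ht₂⟩]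

theorem exists_step (M : RegisterMachine X Q A D) (c : Q × (X → ℤ)) (a : A) :
    ∃ c', M.Step c a c' := by
  obtain ⟨e, ⟨he, hs, hl, ht⟩, -⟩ := M.deterministic c.1 a c.2
  exact ⟨_, e, he, hs, hl, ht, rfl⟩

theorem Reaches.unique {s : List A} {c₁ c₂ : Q × (X → ℤ)} (h₁ : M.Reaches s c₁)
    (h₂ : M.Reaches s c₂) : c₁ = c₂ := by
  induction h₁ generalizing c₂ with
  | nil =>
    generalize ht : ([] : List A) = t at h₂
    cases h₂ with
    | nil => rfl
    | snoc _ _ => simp at ht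
  | snoc hr hs ih =>
    obtain ⟨c, hc, hs'⟩ := h₂.exists_of_append_singleton
    obtain rfl := ih hc
    exact hs.unique hs'

theorem exists_reaches (M : RegisterMachine X Q A D) (s : List A) : ∃ c, M.Reaches s c := by
  induction s using List.reverseRecOn with
  | nil => exact ⟨_, .nil⟩
  | append_singleton s a ih =>
    obtain ⟨c, hc⟩ := ih
    obtain ⟨c', hc'⟩ := M.exists_step c a
    exact ⟨c', hc.snoc hc'⟩

theorem Generates.out_eq {v : List A → D} (hv : M.Generates v) {s : List A} {c : Q × (X → ℤ)}
    (hc : M.Reaches s c) : M.out c.1 c.2 = v s := by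
  obtain ⟨c', hc', h⟩ := hv s
  rwa [hc.unique hc']

/-- Two traces that lead to the same configuration after `n` letters and agree from then on lead
to the same configuration at every later time. -/
theorem Reaches.pref_of_le {f g : ℕ → A} {n N : ℕ} {c : Q × (X → ℤ)}
    (hf : M.Reaches (pref f n) c) (hg : M.Reaches (pref g n) c)
    (h : ∀ i, n ≤ i → f i = g i) (hN : n ≤ N) :
    ∃ c', M.Reaches (pref f N) c' ∧ M.Reaches (pref g N) c' := by
  induction N, hN using Nat.le_induction with
  | base => exact ⟨c, hf, hg⟩
  | succ N hN ih =>
    obtain ⟨d, hdf, hdg⟩ := ih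
    obtain ⟨d', hd'⟩ := M.exists_step d (f N)
    refine ⟨d', ?_, ?_⟩
    · rw [pref_succ]
      exact hdf.snoc hd'
    · rw [pref_succ, ← h N hN]
      exact hdg.snoc hd'

end RegisterMachine

/-! ### Linear growth of the registers of a counter machine -/

/-- A counter test only depends on the order pattern of the valuation. -/
theorem IsCounterTest.mem_iff {X : Type*} {φ : Set (X → ℤ)} (hφ : IsCounterTest φ)
    {w w' : X → ℤ} (h : ∀ x y, w x ≥ w y ↔ w' x ≥ w' y) : w ∈ φ ↔ w' ∈ φ := by
  induction hφ with
  | ge x y => exact h x y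
  | univ => simp
  | compl _ ih => simp [ih]
  | inter _ _ ih₁ ih₂ => simp [ih₁, ih₂]

theorem IsCounterUpdate.exists_bound {X : Type*} [DecidableEq X] {γ : (X → ℤ) → (X → ℤ)}
    (hγ : IsCounterUpdate γ) :
    ∃ C : ℕ, ∀ (w : X → ℤ) (B : ℕ), (∀ x, 0 ≤ w x ∧ w x ≤ B) →
      ∀ x, 0 ≤ γ w x ∧ γ w x ≤ (B + C : ℕ) := by
  induction hγ with
  | skip => exact ⟨0, fun w B h => by simpa using h⟩
  | reset y _ ih =>
    obtain ⟨C, hC⟩ := ih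
    refine ⟨C, fun w B h x => ?_⟩
    by_cases hx : x = y
    · subst hx
      simp only [Function.update_self]
      exact ⟨le_rfl, by positivity⟩
    · simpa only [Function.update_of_ne hx] using hC w B h x
  | incr y _ ih =>
    obtain ⟨C, hC⟩ := ih
    refine ⟨C + 1, fun w B h x => ?_⟩
    have := hC w B h x
    by_cases hx : x = y
    · subst hx
      simp only [Function.update_self]
      push_cast at this ⊢
      omega
    · simp only [Function.update_of_ne hx]
      push_cast at this ⊢
      omega

/-- The registers of a counter machine are nonnegative and grow at most linearly with the length
of the input. The edge that is taken is determined by the state, the letter and the order pattern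
of the valuation, so finitely many edges account for all transitions, even where `M.edges` is
infinite. -/
theorem RegisterMachine.IsCounterMachine.exists_bound {X Q A : Type*} [DecidableEq X] [Finite X]
    [Finite Q] [Finite A] {M : RegisterMachine X Q A ℕ∞} (hM : M.IsCounterMachine) :
    ∃ C : ℕ, ∀ (s : List A) (c : Q × (X → ℤ)), M.Reaches s c →
      ∀ x, 0 ≤ c.2 x ∧ c.2 x ≤ (C * s.length : ℕ) := by
  have key : ∀ i : Q × A × (X → X → Prop), ∃ C : ℕ, ∀ e ∈ M.edges, e.src = i.1 →
      e.letter = i.2.1 → ∀ u ∈ e.test, (∀ x y, u x ≥ u y ↔ i.2.2 x y) →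
      ∀ (w : X → ℤ) (B : ℕ), (∀ x, 0 ≤ w x ∧ w x ≤ B) →
        ∀ x, 0 ≤ e.update w x ∧ e.update w x ≤ (B + C : ℕ) := by
    rintro ⟨q, a, P⟩
    by_cases h : ∃ u : X → ℤ, ∀ x y, u x ≥ u y ↔ P x y
    · obtain ⟨u₀, hu₀⟩ := h
      obtain ⟨e₀, ⟨he₀, -⟩, huniq⟩ := M.deterministic q a u₀
      obtain ⟨C, hC⟩ := (hM.update e₀ he₀).exists_bound
      refine ⟨C, fun e he hs hl u hu hP => ?_⟩
      have hmem : u₀ ∈ e.test :=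
        ((hM.test e he).mem_iff fun x y => (hP x y).trans (hu₀ x y).symm).1 hu
      rw [huniq e ⟨he, hs, hl, hmem⟩]
      exact hC
    · exact ⟨0, fun e _ _ _ u _ hP => (h ⟨u, hP⟩).elim⟩
  choose K hK using key
  obtain ⟨C, hC⟩ := (Set.finite_range K).bddAbove
  refine ⟨C, fun s c h => ?_⟩
  induction h with
  | nil => simp
  | snoc hr hs ih =>
    rename_i s c c' a
    obtain ⟨e, he, hsrc, hl, ht, rfl⟩ := hs
    intro x
    have h₁ := hK (c.1, a, fun x y => c.2 x ≥ c.2 y) e he hsrc hl c.2 ht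
      (fun _ _ => Iff.rfl) c.2 _ ih x
    have h₂ : K (c.1, a, fun x y => c.2 x ≥ c.2 y) ≤ C := hC ⟨_, rfl⟩
    refine ⟨h₁.1, h₁.2.trans ?_⟩
    rw [List.length_append, List.length_singleton, Nat.mul_add, Nat.mul_one]
    exact_mod_cast Nat.add_le_add_left h₂ _

/-! ### The binary value of the first block -/

instance : Finite Letter :=
  Finite.of_surjective (fun i : Fin 3 => ![Letter.zero, .one, .hash] i) fun
    | .zero => ⟨0, rfl⟩
    | .one => ⟨1, rfl⟩
    | .hash => ⟨2, rfl⟩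

open Classical in
/-- The number written in binary, least significant bit first, before the first `#` of a trace;
it is `∞` for a trace without `#`. -/
noncomputable def firstBlockValue (f : ℕ → Letter) : ℕ∞ :=
  if h : ∃ n, f n = .hash then
    ((Nat.ofBits fun i : Fin (Nat.find h) => decide (f i = .one) : ℕ) : ℕ∞)
  else ⊤

/-- The trace that starts with the `n` low bits of `m`, least significant bit first, and continues
with `#` forever. -/
def bitTrace (n m i : ℕ) : Letter :=
  if i < n then if m.testBit i then .one else .zero else .hash

theorem firstBlockValue_of_agree {f : ℕ → Letter} {n m : ℕ} (hm : m < 2 ^ n)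
    (h : ∀ i < n + 1, f i = bitTrace n m i) : firstBlockValue f = m := by
  classical
  have hn : f n = .hash := by rw [h n n.lt_succ_self, bitTrace, if_neg n.lt_irrefl]
  have hne : ∀ i < n, f i ≠ .hash := fun i hi => by
    rw [h i (Nat.lt_succ_of_lt hi), bitTrace, if_pos hi]
    split <;> simp
  have hex : ∃ n, f n = .hash := ⟨n, hn⟩
  have hfind : Nat.find hex = n := (Nat.find_eq_iff hex).2 ⟨hn, hne⟩
  have hbit : (fun i : Fin n => decide (f i = .one)) = fun i : Fin n => m.testBit i := by
    funext i
    rw [h i (Nat.lt_succ_of_lt i.2), bitTrace, if_pos i.2]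
    cases m.testBit i <;> simp
  have hval : ∀ l, l = n → (Nat.ofBits fun i : Fin l => decide (f i = .one)) = m := by
    rintro l rfl
    rw [hbit, Nat.ofBits_testBit, Nat.mod_eq_of_lt hm]
  rw [firstBlockValue, dif_pos hex]
  exact_mod_cast hval _ hfind

theorem exists_mul_linear_pow_lt_two_pow (a b k : ℕ) : ∃ n : ℕ, a * (b * n + 1) ^ k < 2 ^ n := by
  have h : Tendsto (fun n : ℕ => (n : ℝ) ^ k / 2 ^ n) atTop (nhds 0) :=
    tendsto_pow_const_div_const_pow_of_one_lt k one_lt_two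
  have hpos : (0 : ℝ) < 1 / (a * (b + 1) ^ k + 1) := by positivity
  obtain ⟨n, hn, hn1⟩ := ((h.eventually_lt_const hpos).and (eventually_ge_atTop 1)).exists
  refine ⟨n, ?_⟩
  rw [div_lt_div_iff₀ (by positivity) (by positivity), one_mul] at hn
  have hlt : n ^ k * (a * (b + 1) ^ k + 1) < 2 ^ n := by exact_mod_cast hn
  calc a * (b * n + 1) ^ k ≤ a * ((b + 1) * n) ^ k := by gcongr; nlinarith
    _ ≤ n ^ k * (a * (b + 1) ^ k + 1) := by rw [mul_pow]; nlinarith [Nat.zero_le (n ^ k)]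
    _ < 2 ^ n := hlt

/-- A counter machine in real time cannot tell apart all binary words of some length: two of them
yield the same verdicts once they have been read. -/
theorem exists_bitTrace_collision {k : ℕ} {v : List Letter → ℕ∞} (hv : IsCounterVerdict k v) :
    ∃ n m m' : ℕ, m < 2 ^ n ∧ m' < 2 ^ n ∧ m ≠ m' ∧
      ∀ N ≥ n, v (pref (bitTrace n m) N) = v (pref (bitTrace n m') N) := by
  obtain ⟨Q, _, M, hM, hgen⟩ := hv
  have := Fintype.ofFinite Q
  obtain ⟨C, hC⟩ := hM.exists_bound
  obtain ⟨n, hn⟩ := exists_mul_linear_pow_lt_two_pow (Fintype.card Q) C k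
  choose c hc using fun m : ℕ => M.exists_reaches (pref (bitTrace n m) n)
  have hIcc : ∀ B : ℕ, (Finset.Icc (0 : ℤ) B).card = B + 1 := fun B => by simp
  have hmaps : ∀ m ∈ Finset.range (2 ^ n), c m ∈ (Finset.univ : Finset Q) ×ˢ
      Fintype.piFinset fun _ : Fin k => Finset.Icc (0 : ℤ) (C * n : ℕ) := fun m _ => by
    simp only [Finset.mem_product, Finset.mem_univ, true_and, Fintype.mem_piFinset,
      Finset.mem_Icc]
    simpa only [length_pref] using hC _ _ (hc m)
  obtain ⟨m, hm, m', hm', hne, heq⟩ := Finset.exists_ne_map_eq_of_card_lt_of_maps_to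
    (by simpa only [Finset.card_product, Finset.card_univ, Fintype.card_piFinset_const, hIcc,
      Finset.card_range] using hn) hmaps
  refine ⟨n, m, m', Finset.mem_range.1 hm, Finset.mem_range.1 hm', hne, fun N hN => ?_⟩
  obtain ⟨d, hd, hd'⟩ := (hc m).pref_of_le (heq ▸ hc m')
    (fun i hi => by simp [bitTrace, hi.not_gt]) hN
  rw [← hgen.out_eq hd, ← hgen.out_eq hd']

/-! ### Overriding a verdict by a constant on a regular set of inputs -/

theorem IsCounterTest.lift {k : ℕ} {φ : Set (Fin k → ℤ)} (hφ : IsCounterTest φ) :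
    IsCounterTest {w : Fin (k + 1) → ℤ | w ∘ Fin.castSucc ∈ φ} := by
  induction hφ with
  | ge x y => exact .ge x.castSucc y.castSucc
  | univ => exact .univ
  | compl _ ih => exact ih.compl
  | inter _ _ ih₁ ih₂ => exact ih₁.inter ih₂

/-- Appending to a valuation a value for the last register. -/
def extend {k : ℕ} (w : Fin k → ℤ) (z : ℤ) : Fin (k + 1) → ℤ :=
  Fin.snoc (α := fun _ => ℤ) w z

theorem extend_comp_castSucc {k : ℕ} (w : Fin k → ℤ) (z : ℤ) :
    extend w z ∘ Fin.castSucc = w := by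
  funext i
  simp [extend]

theorem extend_last {k : ℕ} (w : Fin k → ℤ) (z : ℤ) : extend w z (Fin.last k) = z := by
  simp [extend]

theorem extend_castSucc {k : ℕ} (w : Fin k → ℤ) (z : ℤ) (i : Fin k) :
    extend w z i.castSucc = w i := by
  simp [extend]

theorem extend_comp_castSucc_last {k : ℕ} (w : Fin (k + 1) → ℤ) :
    extend (w ∘ Fin.castSucc) (w (Fin.last k)) = w :=
  Fin.snoc_init_self (α := fun _ => ℤ) w

theorem update_extend_castSucc {k : ℕ} (w : Fin k → ℤ) (z : ℤ) (x : Fin k) (y : ℤ) :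
    Function.update (extend w z) x.castSucc y = extend (Function.update w x y) z :=
  (Fin.snoc_update ..).symm

theorem update_extend_last {k : ℕ} (w : Fin k → ℤ) (z y : ℤ) :
    Function.update (extend w z) (Fin.last k) y = extend w y :=
  Fin.update_snoc_last ..

theorem IsCounterUpdate.lift {k : ℕ} {γ : (Fin k → ℤ) → (Fin k → ℤ)} (hγ : IsCounterUpdate γ) :
    IsCounterUpdate fun w : Fin (k + 1) → ℤ =>
      extend (γ (w ∘ Fin.castSucc)) (w (Fin.last k)) := by
  induction hγ with
  | skip =>
    simpa only [extend_comp_castSucc_last] using IsCounterUpdate.skip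
  | reset x _ ih =>
    simpa only [update_extend_castSucc] using ih.reset x.castSucc
  | incr x _ ih =>
    simpa only [update_extend_castSucc, extend_castSucc] using ih.incr x.castSucc

/-- The last register is loaded with a constant by a reset and repeated increments. -/
theorem IsCounterUpdate.lift_const {k : ℕ} {γ : (Fin k → ℤ) → (Fin k → ℤ)}
    (hγ : IsCounterUpdate γ) (c : ℕ) :
    IsCounterUpdate fun w : Fin (k + 1) → ℤ => extend (γ (w ∘ Fin.castSucc)) c := by
  induction c with
  | zero => simpa only [update_extend_last, Nat.cast_zero] using hγ.lift.reset (Fin.last k)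
  | succ c ih =>
    simpa only [update_extend_last, extend_last, Nat.cast_succ] using ih.incr (Fin.last k)

/-- The edge of the product machine that runs along `e` while the automaton `D` is in state `σ`;
it also loads the last register with `c`. -/
def Edge.withDFA {k : ℕ} {Q A S : Type*} (D : DFA A S) (c : ℕ) (e : Edge (Fin k) Q A) (σ : S) :
    Edge (Fin (k + 1)) (Q × S) A where
  src := (e.src, σ)
  letter := e.letter
  test := {w | w ∘ Fin.castSucc ∈ e.test}
  update w := extend (e.update (w ∘ Fin.castSucc)) c
  dst := (e.dst, D.step σ e.letter)

open Classical in
/-- The product of a register machine with a deterministic finite automaton. It has one more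
register, which holds `c` after the first letter and is the output in the states where the
automaton accepts. -/
noncomputable def RegisterMachine.withDFA {k : ℕ} {Q A S : Type*}
    (M : RegisterMachine (Fin k) Q A ℕ∞) (D : DFA A S) (c : ℕ) :
    RegisterMachine (Fin (k + 1)) (Q × S) A ℕ∞ where
  edges := {e' | ∃ e ∈ M.edges, ∃ σ, e' = e.withDFA D c σ}
  init := (M.init, D.start)
  out q w := if q.2 ∈ D.accept then ((w (Fin.last k)).toNat : ℕ∞) else M.out q.1 (w ∘ Fin.castSucc)
  deterministic := by
    rintro ⟨q, σ⟩ a x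
    obtain ⟨e, ⟨he, hs, hl, ht⟩, huniq⟩ := M.deterministic q a (x ∘ Fin.castSucc)
    refine ⟨e.withDFA D c σ, ⟨⟨e, he, σ, rfl⟩, by simp [Edge.withDFA, hs], hl, ht⟩, ?_⟩
    rintro _ ⟨⟨e', he', σ', rfl⟩, hs', hl', ht'⟩
    obtain ⟨hq, rfl⟩ : e'.src = q ∧ σ' = σ := by simpa [Edge.withDFA] using hs'
    rw [huniq e' ⟨he', hq, hl', ht'⟩]

theorem RegisterMachine.IsCounterMachine.withDFA {k : ℕ} {Q A S : Type*}
    {M : RegisterMachine (Fin k) Q A ℕ∞} (hM : M.IsCounterMachine) (D : DFA A S) (c : ℕ) :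
    (M.withDFA D c).IsCounterMachine where
  test := by
    rintro _ ⟨e, he, σ, rfl⟩
    exact (hM.test e he).lift
  update := by
    rintro _ ⟨e, he, σ, rfl⟩
    exact (hM.update e he).lift_const c
  out := by
    rintro ⟨q, σ⟩
    by_cases hσ : σ ∈ D.accept
    · exact .inr (.inr ⟨Fin.last k, fun w => by simp [RegisterMachine.withDFA, hσ]⟩)
    · simp only [RegisterMachine.withDFA, hσ, if_false]
      rcases hM.out q with h | h | ⟨x, h⟩
      · exact .inl fun w => h _
      · exact .inr (.inl fun w => h _)
      · exact .inr (.inr ⟨x.castSucc, fun w => h _⟩)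

theorem RegisterMachine.Reaches.withDFA {k : ℕ} {Q A S : Type*}
    {M : RegisterMachine (Fin k) Q A ℕ∞} (D : DFA A S) (c : ℕ) {s : List A}
    {d : Q × (Fin k → ℤ)} (h : M.Reaches s d) :
    (M.withDFA D c).Reaches s ((d.1, D.eval s), extend d.2 (if s = [] then 0 else c)) := by
  induction h with
  | nil =>
    have h0 : extend (fun _ : Fin k => (0 : ℤ)) 0 = fun _ => 0 :=
      extend_comp_castSucc_last fun _ : Fin (k + 1) => (0 : ℤ)
    simp only [if_true, h0]
    exact .nil
  | snoc _ hs ih =>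
    obtain ⟨e, he, hsrc, rfl, ht, rfl⟩ := hs
    refine ih.snoc ⟨e.withDFA D c (D.eval _), ⟨e, he, _, rfl⟩,
      by rw [Edge.withDFA, hsrc], rfl, ?_, ?_⟩
    · simpa only [Edge.withDFA, Set.mem_ofPred_eq, extend_comp_castSucc] using ht
    · simp [Edge.withDFA, extend_comp_castSucc]

open Classical in
/-- With one more register, a counter verdict can be replaced by a constant on a regular language.
The empty word is excluded because the registers are `0` before the first letter. -/
theorem IsCounterVerdict.ite_accepts {A S : Type} [Finite S] {k : ℕ} {v : List A → ℕ∞}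
    (hv : IsCounterVerdict k v) (D : DFA A S) (hD : [] ∉ D.accepts) (c : ℕ) :
    IsCounterVerdict (k + 1) fun s => if s ∈ D.accepts then (c : ℕ∞) else v s := by
  obtain ⟨Q, _, M, hM, hgen⟩ := hv
  refine ⟨Q × S, inferInstance, M.withDFA D c, hM.withDFA D c, fun s => ?_⟩
  obtain ⟨d, hd⟩ := M.exists_reaches s
  refine ⟨_, hd.withDFA D c, ?_⟩
  by_cases hs : s ∈ D.accepts
  · have hne : s ≠ [] := fun h => hD (h ▸ hs)
    simp [RegisterMachine.withDFA, extend_last, hne, (DFA.mem_accepts D).1 hs, hs]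
  · simp [RegisterMachine.withDFA, extend_comp_castSucc, mt (DFA.mem_accepts D).2 hs, hs,
      hgen.out_eq hd]

/-- The automaton that remembers the first `w.length` letters of its input and accepts the
extensions of `w`. -/
def prefixDFA {A : Type*} (w : List A) : DFA A {l : List A // l.length ≤ w.length} where
  step l a := ⟨(l.1 ++ [a]).take w.length, by simp⟩
  start := ⟨[], by simp⟩
  accept := {l | l.1 = w}

theorem prefixDFA_eval {A : Type*} (w s : List A) :
    ((prefixDFA w).eval s : List A) = s.take w.length := by
  induction s using List.reverseRecOn with
  | nil => simp [prefixDFA]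
  | append_singleton s a ih =>
    rw [DFA.eval_append_singleton]
    change (((prefixDFA w).eval s : List A) ++ [a]).take w.length = _
    rw [ih]
    simp only [List.take_append, List.take_take, min_self, List.length_take]
    congr 2
    omega

theorem mem_accepts_prefixDFA {A : Type*} {w s : List A} :
    s ∈ (prefixDFA w).accepts ↔ w <+: s := by
  rw [DFA.mem_accepts, List.prefix_iff_eq_take, ← prefixDFA_eval, eq_comm]
  rfl

open Classical in
theorem IsCounterVerdict.ite_prefix {A : Type} [Finite A] {k : ℕ} {v : List A → ℕ∞}
    (hv : IsCounterVerdict k v) {w : List A} (hw : w ≠ []) (c : ℕ) :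
    IsCounterVerdict (k + 1) fun s => if w <+: s then (c : ℕ∞) else v s := by
  have : Finite {l : List A // l.length ≤ w.length} := (List.finite_length_le A w.length).to_subtype
  simpa only [mem_accepts_prefixDFA] using
    hv.ite_accepts (prefixDFA w) (by simpa [mem_accepts_prefixDFA] using hw) c

/-! ### Exact verdicts on one more block -/

/-- For each bit trace `g`, an additional register suffices to make a counter verdict exact on all
traces that share the first block of `g`, without a change of its limits elsewhere. -/
theorem IsCounterVerdict.exists_exact_on_block {k : ℕ} {v : List Letter → ℕ∞}
    (hv : IsCounterVerdict k v) {n m : ℕ} (hm : m < 2 ^ n) :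
    ∃ v' : List Letter → ℕ∞, IsCounterVerdict (k + 1) v' ∧
      (∀ f, (vLimsup v' f = firstBlockValue f ∧ vLiminf v' f = firstBlockValue f) ∨
        (vLimsup v' f = vLimsup v f ∧ vLiminf v' f = vLiminf v f)) ∧
      vLimsup v' (bitTrace n m) = firstBlockValue (bitTrace n m) ∧
      vLiminf v' (bitTrace n m) = firstBlockValue (bitTrace n m) := by
  classical
  set w := pref (bitTrace n m) (n + 1) with hw
  have hw0 : w ≠ [] := by simp [hw, pref_succ]
  have exact_of_agree : ∀ f, (∀ i < n + 1, f i = bitTrace n m i) →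
      vLimsup (fun s => if w <+: s then (m : ℕ∞) else v s) f = firstBlockValue f ∧
        vLiminf (fun s => if w <+: s then (m : ℕ∞) else v s) f = firstBlockValue f := by
    intro f hf
    have hev : (fun N => if w <+: pref f N then (m : ℕ∞) else v (pref f N)) =ᶠ[atTop]
        fun _ => (m : ℕ∞) := by
      filter_upwards [eventually_ge_atTop (n + 1)] with N hN
      exact if_pos (pref_prefix_pref_iff.2 ⟨hN, hf⟩)
    rw [firstBlockValue_of_agree hm hf]
    exact ⟨(limsup_congr hev).trans (limsup_const _), (liminf_congr hev).trans (liminf_const _)⟩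
  refine ⟨_, hv.ite_prefix hw0 m, fun f => ?_, exact_of_agree _ fun _ _ => rfl⟩
  by_cases hf : ∀ i < n + 1, f i = bitTrace n m i
  · exact .inl (exact_of_agree f hf)
  · have hneg : ∀ N, ¬ w <+: pref f N := fun N h => hf (pref_prefix_pref_iff.1 h).2
    right
    simp [vLimsup, vLiminf, hneg]

theorem exists_bitTrace_vLimsup_ne {k : ℕ} {v : List Letter → ℕ∞} (hv : IsCounterVerdict k v) :
    ∃ n m : ℕ, m < 2 ^ n ∧ vLimsup v (bitTrace n m) ≠ firstBlockValue (bitTrace n m) := by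
  obtain ⟨n, m, m', hm, hm', hne, h⟩ := exists_bitTrace_collision hv
  by_contra! H
  have hlim : vLimsup v (bitTrace n m) = vLimsup v (bitTrace n m') :=
    limsup_congr ((eventually_ge_atTop n).mono h)
  rw [H n m hm, H n m' hm', firstBlockValue_of_agree hm fun _ _ => rfl,
    firstBlockValue_of_agree hm' fun _ _ => rfl] at hlim
  exact hne (by exact_mod_cast hlim)

theorem exists_bitTrace_vLiminf_ne {k : ℕ} {v : List Letter → ℕ∞} (hv : IsCounterVerdict k v) :
    ∃ n m : ℕ, m < 2 ^ n ∧ vLiminf v (bitTrace n m) ≠ firstBlockValue (bitTrace n m) := by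
  obtain ⟨n, m, m', hm, hm', hne, h⟩ := exists_bitTrace_collision hv
  by_contra! H
  have hlim : vLiminf v (bitTrace n m) = vLiminf v (bitTrace n m') :=
    liminf_congr ((eventually_ge_atTop n).mono h)
  rw [H n m hm, H n m' hm', firstBlockValue_of_agree hm fun _ _ => rfl,
    firstBlockValue_of_agree hm' fun _ _ => rfl] at hlim
  exact hne (by exact_mod_cast hlim)

end QuantMonitor

open QuantMonitor in
theorem mainTheorem9 :
    ∃ p : (ℕ → Letter) → ℕ∞,
      ∀ k : ℕ, 1 < k → ∀ v : List Letter → ℕ∞, QuantMonitor.IsCounterVerdict k v →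
        (QuantMonitor.ApproxBelow v p →
          ∃ v' : List Letter → ℕ∞, QuantMonitor.IsCounterVerdict (k + 1) v' ∧
            QuantMonitor.ApproxBelow v' p ∧ QuantMonitor.MorePreciseBelow v' v) ∧
        (QuantMonitor.ApproxAbove v p →
          ∃ v' : List Letter → ℕ∞, QuantMonitor.IsCounterVerdict (k + 1) v' ∧
            QuantMonitor.ApproxAbove v' p ∧ QuantMonitor.MorePreciseAbove v' v) := by
  refine ⟨firstBlockValue, fun k _ v hv => ⟨fun hb => ?_, fun ha => ?_⟩⟩
  · obtain ⟨n, m, hm, hne⟩ := exists_bitTrace_vLimsup_ne hv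
    obtain ⟨v', hv', hall, hg, -⟩ := hv.exists_exact_on_block hm
    refine ⟨v', hv', fun f => ?_, fun f => ?_, bitTrace n m, ?_⟩
    · rcases hall f with h | h
      · exact h.1.le
      · exact h.1.trans_le (hb f)
    · rcases hall f with h | h
      · exact (hb f).trans_eq h.1.symm
      · exact h.1.ge
    · exact hg ▸ (hb _).lt_of_ne hne
  · obtain ⟨n, m, hm, hne⟩ := exists_bitTrace_vLiminf_ne hv
    obtain ⟨v', hv', hall, -, hg⟩ := hv.exists_exact_on_block hm
    refine ⟨v', hv', fun f => ?_, fun f => ?_, bitTrace n m, ?_⟩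
    · rcases hall f with h | h
      · exact h.2.ge
      · exact (ha f).trans_eq h.2.symm
    · rcases hall f with h | h
      · exact h.2.trans_le (ha f)
      · exact h.2.le
    · exact hg ▸ (ha _).lt_of_ne hne.symm
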